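/- **Setting.** Let $\mathcal K$ be a nonempty finite set of players and $A$, $Q$, $X$, $S_i$, $Y_i$ ($i\in\mathcal K$) finite sets, $X\neq\emptyset$. A monitoring structure $\mathcal M=(m,(g_i)_{i\in\mathcal K},f)$ consists of the mediator's observation channel $m:A\to\Delta(Q)$, the private monitorings $g_i:A\to\Delta(S_i)$, and a channel $f:X\to\Delta(\prod_{i}Y_i)$ from the mediator to the players, with marginals $f_i(y_i|x)$. Fix $p\in\Delta(A)$ and $\varepsilon>0$. **Coloring condition.** Write $a\sim_{g_i}b$ if $\{s: g_i(s|a)>1/2\}=\{s: g_i(s|b)>1/2\}$, and $a\sim_m b$ if $\{q: m(q|a)>1/2\}=\{q: m(q|b)>1/2\}$. Let $\mathcal G_i$ be the graph on $A$ in which distinct $a,b$ are adjacent iff $a\sim_{g_i}b$. Let $(Q_\beta)_{\beta\in A/\sim_m}$ be a partition of $Q$ (cells may be empty). For $x,y\in[0,1]$, the pair $(g_i,m)$ satisfies the $(x,y)$-coloring condition with $(Q_\beta)$ if - there is a partition $(S_\alpha)_{\alpha\in A/\sim_{g_i}}$ of $S_i$ with $\sum_{s\in S_\alpha}g_i(s|a)\ge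 1-x$ for all $\alpha$ and all $a\in\alpha$; - $\sum_{q\in Q_\beta}m(q|a)\ge 1-y$ for all $\beta$ and all $a\in\beta$; - $a\mapsto Q_{\beta(a)}$, where $\beta(a)$ is the $\sim_m$-class of $a$, is a coloring of $\mathcal G_i$, that is, adjacent $a,b$ have $\beta(a)\ne\beta(b)$. **Essential rate.** The bi-auxiliary graph on $Q$ joins distinct $q,q'$ iff $q\in Q_{\beta(a)}$ and $q'\in Q_{\beta(b)}$ for some $i\in\mathcal K$ and some $a,b$ adjacent in $\mathcal G_i$. Let $\tilde h:Q\to R$ be a coloring of it with the minimal number $|R|$ of colors. The essential rate is $H=\max_i H(r|s_i)$, where $P(r,s_i)=\sum_{a}p(a)\,g_i(s_i|a)\sum_{q:\tilde h(q)=r}m(q|a)$. Let $C_0=\max_{P\in\Delta(X)}\min_i I(X;Y_i)$ be the common-message capacity of $f$. **Reconstruction.** A code of length $n\ge1$ consists of $h:Q\to R'$ with $R'$ finite, $\phi:R'^n\to X^n$ and $\psi_i:Y_i^n\times S_i^n\to A^n$ for each $i$. The profiles $a_1,\dots,a_n$ are i.i.d. with law $p$; given $a_t$, the signals $q_t$ and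 $s_{i,t}$ are drawn independently from $m(\cdot|a_t)$ and $g_i(\cdot|a_t)$; with $r_t=h(q_t)$, the input $\phi(r_1,\dots,r_n)$ is sent through the memoryless channel $f$, and player $i$ receives $y_i^n$. For $\eta\ge0$, the mediator can reconstruct the $\varepsilon$-perfect monitoring up to a fraction $\eta$ of the stages if for every $\delta>0$ there is a code such that for every player $i$ there is a partition $(T_i^a)_{a\in A}$ of $S_i\times R'$ such that $$\sum_{(s,r)\in T_i^a}\Lambda_i(s,r|a)\ge 1-\varepsilon\quad\text{for all }a\in A,\qquad \Lambda_i(s,r|a)=g_i(s|a)\sum_{q:h(q)=r}m(q|a),$$ and, with probability at least $1-\delta$, the $t$-th entry of $\psi_i(y_i^n,s_i^n)$ is the $a$ with $(s_{i,t},r_t)\in T_i^a$ for all but at most $\eta n$ of the stages $t$. If this holds with $\eta=0$, the mediator can reconstruct the $\varepsilon$-perfect monitoring. **Theorem.** Suppose that 1. there are $x,y\in[0,1]$ with $x+y-xy\le\varepsilon$ such that for every $i\in\mathcal K$ the pair $(g_i,m)$ satisfies the $(x,y)$-coloring condition with $(Q_\beta)$; 2. $H\le C_0$. Then the mediator can reconstruct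 the $\varepsilon$-perfect monitoring up to a fraction $\eta$ of the stages, for every $\eta>0$; and if $H<C_0$, the mediator can reconstruct the $\varepsilon$-perfect monitoring (at all stages of the block). -/

import Mathlib

open Classical in
/-- The matrix `W` of a monitoring `W : A → Δ(Z)` identifies the class `c a` of the action profile
`a` with precision `e`: the cells `{z | T z = γ}`, indexed by the classes `γ`, partition the
signals, and under every `a` the cell of `c a` has probability at least `1 - e`. -/
def PreciseVia {A Z C : Type*} [Fintype Z] (W : A → Z → ℝ) (c : A → C) (T : Z → C) (e : ℝ) :
    Prop :=
  ∀ a : A, 1 - e ≤ ∑ z, if T z = c a then W a z else 0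

/-- The signals that have probability more than `1/2` under the action profile `a`. -/
def majoritySet {A Z : Type*} [Fintype Z] (W : A → stdSimplex ℝ Z) (a : A) : Set Z :=
  {z | 1 / 2 < W a z}

/-- The equivalence `a ∼_W b`: the same signals have probability more than `1/2`. -/
def majoritySetoid {A Z : Type*} [Fintype Z] (W : A → stdSimplex ℝ Z) : Setoid A :=
  Setoid.ker (majoritySet W)

/-- The set `A_W` of equivalence classes of action profiles. -/
abbrev ActionClass {A Z : Type*} [Fintype Z] (W : A → stdSimplex ℝ Z) : Type _ :=
  Quotient (majoritySetoid W)

/-- The equivalence class of an action profile. -/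
def actionClass {A Z : Type*} [Fintype Z] (W : A → stdSimplex ℝ Z) (a : A) : ActionClass W :=
  Quotient.mk (majoritySetoid W) a

/-- The auxiliary graph: distinct action profiles are adjacent when they are equivalent. -/
def auxiliaryGraph {A Z : Type*} [Fintype Z] (W : A → stdSimplex ℝ Z) : SimpleGraph A where
  Adj a b := a ≠ b ∧ majoritySetoid W a b
  symm := ⟨fun _ _ h => ⟨h.1.symm, (majoritySetoid W).symm h.2⟩⟩
  loopless := ⟨fun _ h => h.1 rfl⟩

/-- The `(x, y)`-coloring condition on the private monitoring `g` and the mediator's monitoring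
`m`, for the partition `Q_β = {q | κ q = β}` of the mediator's signals: the auxiliary monitoring
of `g` is `x`-perfect, that of `m` is `y`-perfect via `(Q_β)`, and `a ↦ Q_{β(a)}`
is a coloring of the auxiliary graph of `g`. -/
def ColoringCondition {A S Q : Type*} [Fintype S] [Fintype Q] (g : A → stdSimplex ℝ S)
    (m : A → stdSimplex ℝ Q) (κ : Q → ActionClass m) (x y : ℝ) : Prop :=
  (∃ T : S → ActionClass g, PreciseVia (fun a s => g a s) (actionClass g) T x) ∧
  PreciseVia (fun a q => m a q) (actionClass m) κ y ∧
  ∀ a b, (auxiliaryGraph g).Adj a b → actionClass m a ≠ actionClass m b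

/-- Shannon entropy (in nats) of a mass function on a finite set. -/
noncomputable def entropyOf {Z : Type*} [Fintype Z] (P : Z → ℝ) : ℝ :=
  ∑ z, Real.negMulLog (P z)

/-- The conditional entropy `H(U|V) = H(U,V) - H(V)` for the joint mass function `P` of
`(U, V)`. -/
noncomputable def condEntropyOf {U V : Type*} [Fintype U] [Fintype V] (P : U → V → ℝ) : ℝ :=
  entropyOf (fun z : U × V => P z.1 z.2) - entropyOf (fun v => ∑ u, P u v)

/-- The mutual information `I(U;V) = H(U) - H(U|V)` for the joint mass function `P` of
`(U, V)`. -/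
noncomputable def mutualInfoOf {U V : Type*} [Fintype U] [Fintype V] (P : U → V → ℝ) : ℝ :=
  entropyOf (fun u => ∑ v, P u v) - condEntropyOf P

/-- A monitoring structure with players `K`: the mediator's observation channel `m`, the private
monitorings `g i`, and the broadcast channel `f` from the mediator to the players. -/
structure MonitoringStructure (K A Q X : Type*) (S Y : K → Type*) [Fintype K] [Fintype Q]
    [∀ i, Fintype (S i)] [Fintype (∀ i, Y i)] where
  /-- The mediator's observation channel. -/
  m : A → stdSimplex ℝ Q
  /-- The private monitorings of the players. -/
  g : ∀ i, A → stdSimplex ℝ (S i)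
  /-- The channel from the mediator to the players. -/
  f : X → stdSimplex ℝ (∀ i, Y i)

/-- A block code of length `n` with essential-information alphabet `R`: the recoloring `h`, the
encoder `φ` of the mediator, and a decoder `ψ i` for each player. -/
structure BlockCode {K : Type*} (A Q X : Type*) (S Y : K → Type*) (R : Type*) (n : ℕ) where
  /-- The essential information extracted from a signal of the mediator. -/
  h : Q → R
  /-- The source-channel encoder. -/
  φ : (Fin n → R) → (Fin n → X)
  /-- The source-channel decoders. -/
  ψ : ∀ i, (Fin n → Y i) → (Fin n → S i) → (Fin n → A)

namespace MonitoringStructure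

variable {K A Q X : Type*} {S Y : K → Type*} [Fintype K] [Fintype Q]
  [∀ i, Fintype (S i)] [Fintype (∀ i, Y i)]

/-- The bi-auxiliary graph on the mediator's signals, for the partition `Q_β = {q | κ q = β}`:
`q` and `q'` are adjacent when they lie in the cells of two action profiles that are adjacent in
the auxiliary graph of some player. -/
def biAuxiliaryGraph (M : MonitoringStructure K A Q X S Y) (κ : Q → ActionClass M.m) :
    SimpleGraph Q where
  Adj q q' := q ≠ q' ∧ ∃ i a b, (auxiliaryGraph (M.g i)).Adj a b ∧
    κ q = actionClass M.m a ∧ κ q' = actionClass M.m b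
  symm := ⟨by
    rintro q q' ⟨hne, i, a, b, hab, ha, hb⟩
    exact ⟨hne.symm, i, b, a, hab.symm, hb, ha⟩⟩
  loopless := ⟨fun _ h => h.1 rfl⟩

open Classical in
/-- The law of the essential information `r = h q` given the action profile `a`. -/
noncomputable def essentialLaw (M : MonitoringStructure K A Q X S Y) {R : Type*} (h : Q → R)
    (a : A) (r : R) : ℝ :=
  ∑ q, if h q = r then M.m a q else 0

/-- The joint monitoring `Λ_i(s, r | a)` of the pair (private signal of player `i`, essential
information). -/
noncomputable def jointMonitoring (M : MonitoringStructure K A Q X S Y) {R : Type*} (h : Q → R)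
    (i : K) (a : A) (σ : S i × R) : ℝ :=
  M.g i a σ.1 * M.essentialLaw h a σ.2

/-- The joint law of `(r, s_i)` when the action profile has law `p`. -/
noncomputable def essentialJoint [Fintype A] (M : MonitoringStructure K A Q X S Y)
    (p : stdSimplex ℝ A) {R : Type*} (h : Q → R) (i : K) (r : R) (s : S i) : ℝ :=
  ∑ a, p a * M.jointMonitoring h i a (s, r)

/-- The essential rate `max_i H(r | s_i)`. -/
noncomputable def essentialRate [Fintype A] (M : MonitoringStructure K A Q X S Y)
    (p : stdSimplex ℝ A) {R : Type*} [Fintype R] (h : Q → R) : ℝ :=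
  ⨆ i, condEntropyOf (M.essentialJoint p h i)

open Classical in
/-- The channel `f_i(y | x)` from the mediator to player `i`, a marginal of `f`. -/
noncomputable def marginalChannel (M : MonitoringStructure K A Q X S Y) (i : K) (x : X)
    (y : Y i) : ℝ :=
  ∑ z : (∀ j, Y j), if z i = y then M.f x z else 0

/-- The common-message capacity `C₀ = max_{p ∈ Δ(X)} min_i I(X; Y_i)` of the channel `f`. -/
noncomputable def commonCapacity [Fintype X] [∀ i, Fintype (Y i)]
    (M : MonitoringStructure K A Q X S Y) : ℝ :=
  ⨆ P : stdSimplex ℝ X, ⨅ i, mutualInfoOf (fun x (y : Y i) => P x * M.marginalChannel i x y)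

open Classical in
/-- Player `i`'s probability of an event on the block
`(a^n, q^n, s_i^n, y_i^n)`: the action profiles are i.i.d. with law `p`, the signals `q_t` and
`s_{i,t}` are drawn from `m(·|a_t)` and `g_i(·|a_t)`, the mediator sends `φ(h(q_1), …, h(q_n))`,
and the channel to player `i` is memoryless. -/
noncomputable def blockProb [Fintype A] [∀ i, Fintype (Y i)]
    (M : MonitoringStructure K A Q X S Y) (p : stdSimplex ℝ A) {R : Type*} {n : ℕ}
    (C : BlockCode A Q X S Y R n) (i : K)
    (E : (Fin n → A) → (Fin n → Q) → (Fin n → S i) → (Fin n → Y i) → Prop) : ℝ :=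
  ∑ a : Fin n → A, ∑ q : Fin n → Q, ∑ s : Fin n → S i, ∑ y : Fin n → Y i,
    if E a q s y then
      ∏ t, p (a t) * M.m (a t) (q t) * M.g i (a t) (s t) *
        M.marginalChannel i (C.φ (fun u => C.h (q u)) t) (y t)
    else 0

open Classical in
/-- Reconstruction of the `ε`-perfect monitoring up to a fraction `η` of the stages: for every
`δ > 0` there is a block code such that every player `i` has a partition `(T_i^a)_a` of the pairs
`(s, r)`, encoded by `T`, via which the joint monitoring is `ε`-perfect, and with probability at
least `1 - δ` the decoder of player `i` outputs `T (s_t, r_t)` at all but at most `η n` of the `n`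
stages. -/
def ReconstructsUpTo [Fintype A] [∀ i, Fintype (Y i)] (M : MonitoringStructure K A Q X S Y)
    (p : stdSimplex ℝ A) (ε η : ℝ) : Prop :=
  ∀ δ : ℝ, 0 < δ → ∃ (n N : ℕ) (C : BlockCode A Q X S Y (Fin N) n), 1 ≤ n ∧
    ∀ i, ∃ T : S i × Fin N → A,
      PreciseVia (M.jointMonitoring C.h i) id T ε ∧
      1 - δ ≤ M.blockProb p C i (fun _ q s y =>
        ((Finset.univ.filter fun t => C.ψ i y s t ≠ T (s t, C.h (q t))).card : ℝ) ≤ η * n)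

/-- The mediator can reconstruct the `ε`-perfect monitoring: with probability at least `1 - δ`
all the stages of the block are reconstructed. -/
def Reconstructs [Fintype A] [∀ i, Fintype (Y i)] (M : MonitoringStructure K A Q X S Y)
    (p : stdSimplex ℝ A) (ε : ℝ) : Prop :=
  M.ReconstructsUpTo p ε 0

end MonitoringStructure

/-! Two independent arguments combine.

Identification. Given the profile, the private signal and the mediator's signal are independent, so
both fall in their correct cells with probability at least `(1 - x) * (1 - y) ≥ 1 - ε`. On that
event the private class and the color determine the profile: two candidates would be adjacent for
the player, so their mediator cells differ, and signals from these cells cannot share a color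
(`exists_preciseVia`).

Transmission. This is joint source-channel coding with side information, without separate binning:
every source word gets an independent random codeword, and receiver `i` seeks a word whose density
`P(w,s) V(y|c w)` exceeds `τ` times the product of the marginals. The true word fails with
probability at most `τ ^ ρ` times moments of the information densities (Markov), and wrong words
pass with total probability at most `1 / τ` (change of measure). Averaging the errors summed over
receivers gives one codebook for all (`exists_codebook`). The moments are multiplicative over
letters, with derivatives `H(r|s)` and `-I` at `0`, so the error decays geometrically when `k H < n
I` (`exists_exponent`, `exists_blockCode`).

At equality of rate and capacity, leaving a small fraction of the letters uncoded creates slack if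
the capacity is positive. Otherwise the conditional entropies vanish and the side information
suffices. -/

/-! ### Finite product laws -/

open Classical in
/-- The image of a product law under a coordinatewise map is the product of the images. -/
theorem sum_prod_mul_comp {ι Z Z' : Type*} [Fintype ι] [DecidableEq ι] [Fintype Z] [Fintype Z']
    (μ : ι → Z → ℝ) (f : ι → Z → Z') (G : (ι → Z') → ℝ) :
    ∑ z : ι → Z, (∏ t, μ t (z t)) * G (fun t => f t (z t)) =
      ∑ w : ι → Z', (∏ t, ∑ z, if f t z = w t then μ t z else 0) * G w := by
  simp_rw [Fintype.prod_sum, Finset.sum_mul]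
  rw [Finset.sum_comm]
  refine Finset.sum_congr rfl fun z _ => ?_
  simp_rw [Fintype.prod_ite_zero, ← funext_iff, ite_mul, zero_mul]
  simp

theorem sum_sum_prod {ι U V : Type*} [Fintype ι] [DecidableEq ι] [Fintype U] [Fintype V]
    (F : ι → U → V → ℝ) :
    ∑ u : ι → U, ∑ v : ι → V, ∏ t, F t (u t) (v t) = ∏ t, ∑ u, ∑ v, F t u v := by
  rw [Fintype.prod_sum]
  exact Finset.sum_congr rfl fun u _ => (Fintype.prod_sum fun t v => F t (u t) v).symm

/-! ### Random codebooks -/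

theorem sum_codebook {W X : Type*} [Fintype W] [DecidableEq W] [Fintype X] (μ : X → ℝ)
    (hμ : ∑ x, μ x = 1) : ∑ c : W → X, ∏ w, μ (c w) = 1 := by
  rw [← Fintype.prod_sum fun (_ : W) x => μ x]
  simp [hμ]

theorem sum_codebook_apply {W X : Type*} [Fintype W] [DecidableEq W] [Fintype X] (μ : X → ℝ)
    (hμ : ∑ x, μ x = 1) (w₀ : W) (f : X → ℝ) :
    ∑ c : W → X, (∏ w, μ (c w)) * f (c w₀) = ∑ x, μ x * f x := by
  have h : ∀ c : W → X, (∏ w, μ (c w)) * f (c w₀) =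
      ∏ w, μ (c w) * (if w = w₀ then f (c w) else 1) := fun c => by
    rw [Finset.prod_mul_distrib]; simp
  simp_rw [h]
  rw [← Fintype.prod_sum fun w x => μ x * (if w = w₀ then f x else 1),
    Finset.prod_eq_single w₀] <;> simp +contextual [hμ]

/-- Distinct codewords are independent: a wrong codeword carries no information on the output caused
by the true one. -/
theorem sum_codebook_apply_mul {W X : Type*} [Fintype W] [DecidableEq W] [Fintype X] (μ : X → ℝ)
    (hμ : ∑ x, μ x = 1) {w₀ w₁ : W} (hw : w₁ ≠ w₀) (f g : X → ℝ) :
    ∑ c : W → X, (∏ w, μ (c w)) * (f (c w₀) * g (c w₁)) =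
      (∑ x, μ x * f x) * ∑ x, μ x * g x := by
  have h : ∀ c : W → X, (∏ w, μ (c w)) * (f (c w₀) * g (c w₁)) =
      ∏ w, μ (c w) * ((if w = w₀ then f (c w) else 1) * (if w = w₁ then g (c w) else 1)) :=
    fun c => by rw [Finset.prod_mul_distrib, Finset.prod_mul_distrib]; simp
  simp_rw [h]
  rw [← Fintype.prod_sum fun w x =>
      μ x * ((if w = w₀ then f x else 1) * (if w = w₁ then g x else 1)),
    ← Finset.mul_prod_erase _ _ (Finset.mem_univ w₀),
    ← Finset.mul_prod_erase _ _ (Finset.mem_erase.2 ⟨hw, Finset.mem_univ w₁⟩),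
    Finset.prod_eq_one]
  · simp [hw, hw.symm]
  · intro w hw'
    simp only [Finset.mem_erase] at hw'
    simp [hw'.1, hw'.2.1, hμ]

/-! ### Moments of the information densities -/

/-- The moment of order `-ρ` of the posterior probability `P(w|s)`. -/
noncomputable def sourceMoment {W S : Type*} [Fintype W] [Fintype S] (P : W → S → ℝ) (ρ : ℝ) : ℝ :=
  ∑ w, ∑ s, P w s * ((∑ w', P w' s) / P w s) ^ ρ

/-- The moment of order `-ρ` of the density of the channel law with respect to the output law. -/
noncomputable def channelMoment {X Y : Type*} [Fintype X] [Fintype Y] (μ : X → ℝ)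
    (V : X → Y → ℝ) (ρ : ℝ) : ℝ :=
  ∑ x, ∑ y, μ x * V x y * ((∑ x', μ x' * V x' y) / V x y) ^ ρ

theorem sourceMoment_prod {ι W S : Type*} [Fintype ι] [DecidableEq ι] [Fintype W] [Fintype S]
    (P : ι → W → S → ℝ) (hP : ∀ t w s, 0 ≤ P t w s) (ρ : ℝ) :
    sourceMoment (fun (w : ι → W) (s : ι → S) => ∏ t, P t (w t) (s t)) ρ =
      ∏ t, sourceMoment (P t) ρ := by
  simp only [sourceMoment]
  rw [← sum_sum_prod]
  refine Finset.sum_congr rfl fun w _ => Finset.sum_congr rfl fun s _ => ?_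
  rw [← Fintype.prod_sum fun t w' => P t w' (s t), ← Finset.prod_div_distrib,
    ← Real.finsetProd_rpow, ← Finset.prod_mul_distrib]
  exact fun t _ => div_nonneg (Finset.sum_nonneg fun _ _ => hP _ _ _) (hP _ _ _)

theorem channelMoment_prod {ι X Y : Type*} [Fintype ι] [DecidableEq ι] [Fintype X] [Fintype Y]
    (μ : X → ℝ) (V : X → Y → ℝ) (hμ : ∀ x, 0 ≤ μ x) (hV : ∀ x y, 0 ≤ V x y) (ρ : ℝ) :
    channelMoment (fun x : ι → X => ∏ t, μ (x t)) (fun x (y : ι → Y) => ∏ t, V (x t) (y t)) ρ =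
      channelMoment μ V ρ ^ Fintype.card ι := by
  simp only [channelMoment]
  rw [← Finset.card_univ, ← Finset.prod_const, ← sum_sum_prod]
  refine Finset.sum_congr rfl fun x _ => Finset.sum_congr rfl fun y _ => ?_
  simp_rw [← Finset.prod_mul_distrib]
  rw [← Fintype.prod_sum fun t x' => μ x' * V x' (y t), ← Finset.prod_div_distrib,
    ← Real.finsetProd_rpow, ← Finset.prod_mul_distrib]
  exact fun t _ => div_nonneg
    (Finset.sum_nonneg fun _ _ => mul_nonneg (hμ _) (hV _ _)) (hV _ _)

theorem sourceMoment_zero {W S : Type*} [Fintype W] [Fintype S] (P : W → S → ℝ) :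
    sourceMoment P 0 = ∑ w, ∑ s, P w s := by
  simp [sourceMoment]

theorem channelMoment_zero {X Y : Type*} [Fintype X] [Fintype Y] (μ : X → ℝ) (V : X → Y → ℝ) :
    channelMoment μ V 0 = ∑ x, ∑ y, μ x * V x y := by
  simp [channelMoment]

theorem sourceMoment_nonneg {W S : Type*} [Fintype W] [Fintype S] {P : W → S → ℝ}
    (hP : ∀ w s, 0 ≤ P w s) (ρ : ℝ) : 0 ≤ sourceMoment P ρ :=
  Finset.sum_nonneg fun _ _ => Finset.sum_nonneg fun _ _ => mul_nonneg (hP _ _)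
    (Real.rpow_nonneg (div_nonneg (Finset.sum_nonneg fun _ _ => hP _ _) (hP _ _)) _)

theorem channelMoment_nonneg {X Y : Type*} [Fintype X] [Fintype Y] {μ : X → ℝ} {V : X → Y → ℝ}
    (hμ : ∀ x, 0 ≤ μ x) (hV : ∀ x y, 0 ≤ V x y) (ρ : ℝ) : 0 ≤ channelMoment μ V ρ :=
  Finset.sum_nonneg fun _ _ => Finset.sum_nonneg fun _ _ => mul_nonneg (mul_nonneg (hμ _) (hV _ _))
    (Real.rpow_nonneg (div_nonneg
      (Finset.sum_nonneg fun _ _ => mul_nonneg (hμ _) (hV _ _)) (hV _ _)) _)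

/-- The base `e` is unconstrained when `b = 0`, so atoms of mass zero, whose density ratio is a junk
value, need no separate treatment in the moments. -/
theorem hasDerivAt_mul_rpow_zero {b e l : ℝ} (h : b ≠ 0 → 0 < e ∧ b * Real.log e = l)
    (h0 : b = 0 → l = 0) : HasDerivAt (fun ρ : ℝ => b * e ^ ρ) l 0 := by
  by_cases hb : b = 0
  · simp [hb, h0 hb, hasDerivAt_const]
  · obtain ⟨he, rfl⟩ := h hb
    simpa using (Real.hasStrictDerivAt_const_rpow he 0).hasDerivAt.const_mul b

theorem condEntropyOf_eq_sum {W S : Type*} [Fintype W] [Fintype S] (P : W → S → ℝ) :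
    condEntropyOf P = ∑ w, ∑ s,
      (P w s * Real.log (∑ w', P w' s) - P w s * Real.log (P w s)) := by
  simp only [condEntropyOf, entropyOf, Fintype.sum_prod_type, Real.negMulLog,
    Finset.sum_sub_distrib]
  rw [Finset.sum_comm (f := fun w s => P w s * Real.log (∑ w', P w' s))]
  simp only [neg_mul, Finset.sum_neg_distrib, Finset.sum_mul]
  ring

theorem hasDerivAt_sourceMoment {W S : Type*} [Fintype W] [Fintype S] {P : W → S → ℝ}
    (hP : ∀ w s, 0 ≤ P w s) : HasDerivAt (sourceMoment P) (condEntropyOf P) 0 := by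
  have h : HasDerivAt (sourceMoment P) (∑ w, ∑ s,
      (P w s * Real.log (∑ w', P w' s) - P w s * Real.log (P w s))) 0 := by
    unfold sourceMoment
    refine HasDerivAt.fun_sum fun w _ => HasDerivAt.fun_sum fun s _ => ?_
    refine hasDerivAt_mul_rpow_zero (fun hb => ?_) (fun hb => by simp [hb])
    have h1 : 0 < P w s := lt_of_le_of_ne (hP w s) (Ne.symm hb)
    have h2 : 0 < ∑ w', P w' s :=
      h1.trans_le (Finset.single_le_sum (fun w' _ => hP w' s) (Finset.mem_univ w))
    exact ⟨div_pos h2 h1, by rw [Real.log_div h2.ne' h1.ne']; ring⟩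
  exact condEntropyOf_eq_sum P ▸ h

theorem hasDerivAt_channelMoment {X Y : Type*} [Fintype X] [Fintype Y] {μ : X → ℝ}
    {V : X → Y → ℝ} (hμ : ∀ x, 0 ≤ μ x) (hV : ∀ x y, 0 ≤ V x y) (hV1 : ∀ x, ∑ y, V x y = 1) :
    HasDerivAt (channelMoment μ V) (-mutualInfoOf fun x y => μ x * V x y) 0 := by
  have h : HasDerivAt (channelMoment μ V) (∑ x, ∑ y,
      (μ x * V x y * Real.log (∑ x', μ x' * V x' y) -
        (μ x * V x y * Real.log (μ x * V x y) - μ x * Real.log (μ x) * V x y))) 0 := by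
    unfold channelMoment
    refine HasDerivAt.fun_sum fun x _ => HasDerivAt.fun_sum fun y _ => ?_
    refine hasDerivAt_mul_rpow_zero (fun hb => ?_) (fun hb => by
      rcases mul_eq_zero.1 hb with h | h <;> simp [h])
    have h1 : 0 < μ x := lt_of_le_of_ne (hμ x) (Ne.symm (left_ne_zero_of_mul hb))
    have h2 : 0 < V x y := lt_of_le_of_ne (hV x y) (Ne.symm (right_ne_zero_of_mul hb))
    have h3 : 0 < ∑ x', μ x' * V x' y := (mul_pos h1 h2).trans_le
      (Finset.single_le_sum (f := fun x' => μ x' * V x' y)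
        (fun x' _ => mul_nonneg (hμ x') (hV x' y)) (Finset.mem_univ x))
    exact ⟨div_pos h3 h2, by
      rw [Real.log_div h3.ne' h2.ne', Real.log_mul h1.ne' h2.ne']; ring⟩
  convert h using 1
  simp only [mutualInfoOf, condEntropyOf, entropyOf, Fintype.sum_prod_type, Real.negMulLog,
    Finset.sum_sub_distrib, ← Finset.mul_sum, hV1, mul_one]
  rw [Finset.sum_comm (f := fun x y => μ x * V x y * Real.log (∑ x', μ x' * V x' y))]
  simp only [neg_mul, Finset.sum_neg_distrib, Finset.sum_mul]
  ring

/-! ### One-shot joint source-channel coding -/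

open Classical in
/-- The threshold test fails for the transmitted word with small probability. -/
theorem sum_atypical_le {W S X Y : Type*} [Fintype W] [Fintype S] [Fintype X] [Fintype Y]
    {P : W → S → ℝ} {μ : X → ℝ} {V : X → Y → ℝ} (hP : ∀ w s, 0 ≤ P w s) (hμ : ∀ x, 0 ≤ μ x)
    (hV : ∀ x y, 0 ≤ V x y) {τ : ℝ} (hτ : 0 < τ) {ρ : ℝ} (hρ : 0 < ρ) :
    (∑ w, ∑ s, ∑ x, ∑ y, if P w s * V x y < τ * ((∑ w', P w' s) * ∑ x', μ x' * V x' y)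
      then P w s * (μ x * V x y) else 0) ≤ τ ^ ρ * (sourceMoment P ρ * channelMoment μ V ρ) := by
  simp only [sourceMoment, channelMoment, Finset.sum_mul, Finset.mul_sum (s := Finset.univ)]
  simp only [← Finset.mul_sum, ← Finset.sum_mul]
  have : ∀ w s x y, (if P w s * V x y < τ * ((∑ w', P w' s) * ∑ x', μ x' * V x' y)
      then P w s * (μ x * V x y) else 0) ≤
      τ ^ ρ * (P w s * ((∑ w', P w' s) / P w s) ^ ρ *
        (μ x * V x y * ((∑ x', μ x' * V x' y) / V x y) ^ ρ)) := by
    intro w s x y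
    have hA : 0 ≤ ∑ w', P w' s := Finset.sum_nonneg fun w' _ => hP w' s
    have hB : 0 ≤ ∑ x', μ x' * V x' y := Finset.sum_nonneg fun x' _ => mul_nonneg (hμ x') (hV x' y)
    have hA' := div_nonneg hA (hP w s)
    have hB' := div_nonneg hB (hV x y)
    have hJ : 0 ≤ P w s * (μ x * V x y) := mul_nonneg (hP w s) (mul_nonneg (hμ x) (hV x y))
    -- Markov's inequality termwise: when the test fails, the base of the power is at least `1`, so
    -- the power dominates the indicator.
    have key : τ ^ ρ * (P w s * ((∑ w', P w' s) / P w s) ^ ρ *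
        (μ x * V x y * ((∑ x', μ x' * V x' y) / V x y) ^ ρ)) =
        P w s * (μ x * V x y) * (τ * (((∑ w', P w' s) / P w s) *
          ((∑ x', μ x' * V x' y) / V x y))) ^ ρ := by
      rw [Real.mul_rpow hτ.le (mul_nonneg hA' hB'), Real.mul_rpow hA' hB']
      ring
    rw [key]
    split_ifs with h
    · rcases (hP w s).eq_or_lt with h0 | h0
      · simp [← h0]
      rcases (hV x y).eq_or_lt with h1 | h1
      · simp [← h1]
      refine le_mul_of_one_le_right hJ (Real.one_le_rpow ?_ hρ.le)
      rw [div_mul_div_comm, ← mul_div_assoc, one_le_div (mul_pos h0 h1)]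
      exact h.le
    · exact mul_nonneg hJ (Real.rpow_nonneg (mul_nonneg hτ.le (mul_nonneg hA' hB')) _)
  refine (Finset.sum_le_sum fun w _ => Finset.sum_le_sum fun s _ => Finset.sum_le_sum fun x _ =>
    Finset.sum_le_sum fun y _ => this w s x y).trans_eq ?_
  simp only [← Finset.mul_sum, ← Finset.sum_mul]

open Classical in
/-- The expected number of wrong words that pass the threshold test is small. -/
theorem sum_confusable_le {W S X Y : Type*} [Fintype W] [Fintype S] [Fintype X] [Fintype Y]
    {P : W → S → ℝ} {μ : X → ℝ} {V : X → Y → ℝ} (hP : ∀ w s, 0 ≤ P w s)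
    (hP1 : ∑ w, ∑ s, P w s = 1) (hμ : ∀ x, 0 ≤ μ x) (hμ1 : ∑ x, μ x = 1)
    (hV : ∀ x y, 0 ≤ V x y) (hV1 : ∀ x, ∑ y, V x y = 1) {τ : ℝ} (hτ : 0 < τ) :
    (∑ w, ∑ s, ∑ y, ∑ w', if w' ≠ w then P w s * ((∑ x, μ x * V x y) *
      ∑ x, μ x * if τ * ((∑ w', P w' s) * ∑ x', μ x' * V x' y) ≤ P w' s * V x y then 1 else 0)
      else 0) ≤ 1 / τ := by
  have hB : ∀ y, 0 ≤ ∑ x, μ x * V x y := fun y =>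
    Finset.sum_nonneg fun x' _ => mul_nonneg (hμ x') (hV x' y)
  -- Admitting `w' = w` only adds nonnegative terms and lets the sum over `w` collapse to the
  -- marginal of `s`.
  calc _ ≤ ∑ w, ∑ s, ∑ y, ∑ w', P w s * ((∑ x, μ x * V x y) * ∑ x, μ x *
        if τ * ((∑ w', P w' s) * ∑ x', μ x' * V x' y) ≤ P w' s * V x y then 1 else 0) := by
        gcongr with w _ s _ y _ w' _
        split_ifs with h
        · rfl
        · refine mul_nonneg (hP w s) (mul_nonneg (hB y) (Finset.sum_nonneg fun x _ => ?_))
          split_ifs <;> simp [hμ]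
    _ = ∑ s, ∑ w', ∑ x, ∑ y, μ x * ((∑ w, P w s) * (∑ x, μ x * V x y) *
        if τ * ((∑ w', P w' s) * ∑ x', μ x' * V x' y) ≤ P w' s * V x y then 1 else 0) := by
        rw [Finset.sum_comm]
        refine Finset.sum_congr rfl fun s _ => ?_
        rw [Finset.sum_congr rfl fun w _ => Finset.sum_comm, Finset.sum_comm]
        refine Finset.sum_congr rfl fun w' _ => ?_
        rw [Finset.sum_comm]
        conv_rhs => rw [Finset.sum_comm]
        refine Finset.sum_congr rfl fun y _ => ?_
        rw [← Finset.sum_mul, ← mul_assoc, Finset.mul_sum]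
        exact Finset.sum_congr rfl fun x _ => by ring
    -- Change of measure: a passed test bounds the product of the marginals by the joint density
    -- over `τ`.
    _ ≤ ∑ s, ∑ w', ∑ x, ∑ y, μ x * (P w' s * V x y / τ) := by
        gcongr with s _ w' _ x _ y _
        · exact hμ x
        · split_ifs with h
          · rw [mul_one, le_div_iff₀ hτ]
            linarith
          · simpa using div_nonneg (mul_nonneg (hP w' s) (hV x y)) hτ.le
    _ = 1 / τ := by
        simp_rw [← mul_div_assoc, ← Finset.sum_div, ← mul_assoc, ← Finset.mul_sum, hV1, mul_one,
          ← Finset.sum_mul, hμ1, one_mul]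
        rw [Finset.sum_comm, hP1]

open Classical in
/-- A single codebook serves all receivers: receiver `i` decodes the source word `w` from the
channel output and its side information, up to an error controlled by the moments. -/
theorem exists_codebook {K W X : Type*} {S Y : K → Type*} [Fintype K] [Fintype W] [Nonempty W]
    [Fintype X] [∀ i, Fintype (S i)] [∀ i, Fintype (Y i)]
    {P : ∀ i, W → S i → ℝ} {μ : X → ℝ} {V : ∀ i, X → Y i → ℝ} (hP : ∀ i w s, 0 ≤ P i w s)
    (hP1 : ∀ i, ∑ w, ∑ s, P i w s = 1) (hμ : ∀ x, 0 ≤ μ x) (hμ1 : ∑ x, μ x = 1)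
    (hV : ∀ i x y, 0 ≤ V i x y) (hV1 : ∀ i x, ∑ y, V i x y = 1) {τ ρ : K → ℝ}
    (hτ : ∀ i, 0 < τ i) (hρ : ∀ i, 0 < ρ i) :
    ∃ (c : W → X) (d : ∀ i, Y i → S i → W), ∀ i,
      (∑ w, ∑ s, ∑ y, if d i y s ≠ w then P i w s * V i (c w) y else 0) ≤
        ∑ j, (τ j ^ ρ j * (sourceMoment (P j) (ρ j) * channelMoment μ (V j) (ρ j)) + 1 / τ j) := by
  let ok : ∀ i, W → S i → X → Y i → Prop := fun i w s x y =>
    τ i * ((∑ w', P i w' s) * ∑ x', μ x' * V i x' y) ≤ P i w s * V i x y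
  let dec : (W → X) → ∀ i, Y i → S i → W := fun c i y s =>
    if h : ∃ w, ok i w s (c w) y then h.choose else Classical.arbitrary W
  let err : (W → X) → K → ℝ := fun c i =>
    ∑ w, ∑ s, ∑ y, if dec c i y s ≠ w then P i w s * V i (c w) y else 0
  have herr0 : ∀ c i, 0 ≤ err c i := fun c i => Finset.sum_nonneg fun w _ =>
    Finset.sum_nonneg fun s _ => Finset.sum_nonneg fun y _ => by
      split_ifs
      exacts [mul_nonneg (hP i w s) (hV i _ y), le_rfl]
  -- A decoding error forces the true word to fail the test or some wrong word to pass it.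
  have herr : ∀ c i, err c i ≤ ∑ w, ∑ s, ∑ y, (P i w s * (if ¬ ok i w s (c w) y then
      V i (c w) y else 0) + ∑ w', if w' ≠ w then P i w s * (V i (c w) y *
        if ok i w' s (c w') y then 1 else 0) else 0) := by
    intro c i
    refine Finset.sum_le_sum fun w _ => Finset.sum_le_sum fun s _ => Finset.sum_le_sum fun y _ => ?_
    have hnn : ∀ w', 0 ≤ (if w' ≠ w then P i w s * (V i (c w) y *
        if ok i w' s (c w') y then 1 else 0) else 0) := fun w' => by
      split_ifs <;> simp [mul_nonneg (hP i w s) (hV i _ y)]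
    by_cases hw : ok i w s (c w) y
    · have hex : ∃ w, ok i w s (c w) y := ⟨w, hw⟩
      have hdec : dec c i y s = hex.choose := dif_pos hex
      by_cases hd : dec c i y s = w
      · simp only [hd, ne_eq, not_true_eq_false, if_false, hw, mul_zero, zero_add]
        exact Finset.sum_nonneg fun w' _ => hnn w'
      · have := Finset.single_le_sum (fun w' _ => hnn w') (Finset.mem_univ (dec c i y s))
        have hok : ok i (dec c i y s) s (c (dec c i y s)) y := by
          rw [hdec]; exact hex.choose_spec
        rw [if_pos hd, if_pos hok, mul_one] at this
        simpa [hd, hw] using this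
    · have := Finset.sum_nonneg fun w' (_ : w' ∈ Finset.univ) => hnn w'
      simp only [hw, not_false_eq_true, if_true]
      split_ifs
      · linarith
      · linarith [mul_nonneg (hP i w s) (hV i (c w) y)]
  have hmean : ∀ i, ∑ c : W → X, (∏ w, μ (c w)) * err c i ≤
      τ i ^ ρ i * (sourceMoment (P i) (ρ i) * channelMoment μ (V i) (ρ i)) + 1 / τ i := by
    intro i
    calc _ ≤ ∑ c : W → X, (∏ w, μ (c w)) * (∑ w, ∑ s, ∑ y, (P i w s * (if ¬ ok i w s (c w) y then
          V i (c w) y else 0) + ∑ w', if w' ≠ w then P i w s * (V i (c w) y *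
          if ok i w' s (c w') y then 1 else 0) else 0)) :=
          Finset.sum_le_sum fun c _ =>
            mul_le_mul_of_nonneg_left (herr c i) (Finset.prod_nonneg fun _ _ => hμ _)
      _ = ∑ w, ∑ s, ∑ y, (P i w s * (∑ x, μ x * if ¬ ok i w s x y then V i x y else 0) +
          ∑ w', if w' ≠ w then P i w s * ((∑ x, μ x * V i x y) *
            ∑ x, μ x * if ok i w' s x y then 1 else 0) else 0) := by
          simp_rw [Finset.mul_sum]
          rw [Finset.sum_comm]
          refine Finset.sum_congr rfl fun w _ => ?_
          rw [Finset.sum_comm]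
          refine Finset.sum_congr rfl fun s _ => ?_
          rw [Finset.sum_comm]
          refine Finset.sum_congr rfl fun y _ => ?_
          simp_rw [mul_add, Finset.sum_add_distrib, mul_left_comm _ (P i w s), ← Finset.mul_sum]
          rw [sum_codebook_apply μ hμ1 w fun x => if ¬ ok i w s x y then V i x y else 0]
          congr 1
          simp_rw [Finset.mul_sum]
          rw [Finset.sum_comm]
          refine Finset.sum_congr rfl fun w' _ => ?_
          split_ifs with hw
          · simp_rw [mul_left_comm _ (P i w s), ← Finset.mul_sum]
            rw [sum_codebook_apply_mul μ hμ1 hw (fun x => V i x y)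
              fun x => if ok i w' s x y then 1 else 0]
          · simp
      _ ≤ _ := by
          simp_rw [Finset.sum_add_distrib]
          refine add_le_add ?_ (sum_confusable_le (hP i) (hP1 i) hμ hμ1 (hV i) (hV1 i) (hτ i))
          refine le_trans (le_of_eq ?_) (sum_atypical_le (hP i) hμ (hV i) (hτ i) (hρ i))
          refine Finset.sum_congr rfl fun w _ => Finset.sum_congr rfl fun s _ => ?_
          rw [Finset.sum_comm]
          refine Finset.sum_congr rfl fun y _ => ?_
          rw [Finset.mul_sum]
          refine Finset.sum_congr rfl fun x _ => ?_
          simp only [ok, not_le]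
          split_ifs <;> ring
  by_contra! hcon
  have hbad : ∀ c : W → X,
      ∑ j, (τ j ^ ρ j * (sourceMoment (P j) (ρ j) * channelMoment μ (V j) (ρ j)) + 1 / τ j) <
        ∑ i, err c i := fun c => by
    obtain ⟨i, hi⟩ := hcon c (dec c)
    exact hi.trans_le (Finset.single_le_sum (fun i _ => herr0 c i) (Finset.mem_univ i))
  have hsum : ∑ c : W → X, (∏ w, μ (c w)) * ∑ i, err c i ≤
      ∑ j, (τ j ^ ρ j * (sourceMoment (P j) (ρ j) * channelMoment μ (V j) (ρ j)) + 1 / τ j) := by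
    simp_rw [Finset.mul_sum]
    rw [Finset.sum_comm]
    exact Finset.sum_le_sum fun i _ => hmean i
  have hone := sum_codebook (W := W) μ hμ1
  -- A codebook of positive weight makes the averaged inequality strict.
  obtain ⟨c₀, -, hc₀⟩ : ∃ c ∈ (Finset.univ : Finset (W → X)), ∏ w, μ (c w) ≠ 0 :=
    Finset.exists_ne_zero_of_sum_ne_zero (by rw [hone]; exact one_ne_zero)
  refine absurd hsum (not_le.2 ?_)
  calc _ = ∑ c : W → X, (∏ w, μ (c w)) *
        ∑ j, (τ j ^ ρ j * (sourceMoment (P j) (ρ j) * channelMoment μ (V j) (ρ j)) + 1 / τ j) := by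
        rw [← Finset.sum_mul, hone, one_mul]
    _ < _ := Finset.sum_lt_sum (fun c _ => mul_le_mul_of_nonneg_left (hbad c).le
      (Finset.prod_nonneg fun _ _ => hμ _)) ⟨c₀, Finset.mem_univ _,
        mul_lt_mul_of_pos_left (hbad c₀)
          (lt_of_le_of_ne (Finset.prod_nonneg fun _ _ => hμ _) (Ne.symm hc₀))⟩

open Filter Topology in
/-- If the rate constraint is strict, the error exponent is positive. -/
theorem exists_exponent {R S X Y : Type*} [Fintype R] [Fintype S] [Fintype X] [Fintype Y]
    {P : R → S → ℝ} {μ : X → ℝ} {V : X → Y → ℝ} (hP : ∀ r s, 0 ≤ P r s)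
    (hP1 : ∑ r, ∑ s, P r s = 1) (hμ : ∀ x, 0 ≤ μ x) (hμ1 : ∑ x, μ x = 1)
    (hV : ∀ x y, 0 ≤ V x y) (hV1 : ∀ x, ∑ y, V x y = 1) {k n : ℕ}
    (h : k * condEntropyOf P < n * mutualInfoOf fun x y => μ x * V x y) :
    ∃ γ > 0, ∃ ρ > 0, Real.exp (γ * ρ) * (sourceMoment P ρ ^ k * channelMoment μ V ρ ^ n) < 1 := by
  set H := condEntropyOf P
  set I := mutualInfoOf fun x y => μ x * V x y
  have hA0 : sourceMoment P 0 = 1 := by rw [sourceMoment_zero, hP1]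
  have hB0 : channelMoment μ V 0 = 1 := by
    simp [channelMoment_zero, ← Finset.mul_sum, hV1, hμ1]
  -- Half the slack: the function of `ρ` equals `1` at `0` and has derivative `γ + k * H - n * I =
  -- -γ` there, so it drops below `1` at some small `ρ > 0`.
  refine ⟨(n * I - k * H) / 2, by linarith, ?_⟩
  set γ := (n * I - k * H) / 2
  have hd := ((((hasDerivAt_id (0 : ℝ)).const_mul γ).exp).mul
    (((hasDerivAt_sourceMoment hP).pow k).mul ((hasDerivAt_channelMoment hμ hV hV1).pow n)))
  have hd' := hasDerivAt_iff_tendsto_slope.1 hd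
  have hneg := (hd'.mono_left (nhdsGT_le_nhdsNE 0)).eventually_lt_const (u := 0) (by
    simp only [id, hA0, hB0, one_pow, mul_one, mul_zero, Real.exp_zero, one_mul, Pi.pow_apply,
      Pi.mul_apply]
    change γ + (k * H + n * -I) < 0
    simp only [γ]
    linarith)
  obtain ⟨ρ, hρ, hρ0⟩ := (hneg.and self_mem_nhdsWithin).exists
  refine ⟨ρ, hρ0, ?_⟩
  have hρ0 : 0 < ρ := hρ0
  simp only [slope_def_field, id, hA0, hB0, one_pow, mul_one, mul_zero, Real.exp_zero,
    Pi.pow_apply, Pi.mul_apply, sub_zero] at hρ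
  rw [div_neg_iff] at hρ
  rcases hρ with hρ | hρ <;> linarith [hρ.1, hρ.2]

/-! ### Laws of signals and blocks -/

namespace MonitoringStructure

variable {K A Q X : Type*} {S Y : K → Type*} [Fintype K] [Fintype Q]
  [∀ i, Fintype (S i)] [Fintype (∀ i, Y i)]

theorem marginalChannel_nonneg (M : MonitoringStructure K A Q X S Y) (i : K) (x : X) (y : Y i) :
    0 ≤ M.marginalChannel i x y :=
  Finset.sum_nonneg fun _ _ => by split_ifs <;> simp

theorem sum_marginalChannel [∀ i, Fintype (Y i)] (M : MonitoringStructure K A Q X S Y) (i : K)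
    (x : X) : ∑ y, M.marginalChannel i x y = 1 := by
  classical
  simp only [marginalChannel]
  rw [Finset.sum_comm]
  simp

/-- The joint law of the mediator's signal and the signal of player `i`. -/
noncomputable def signalJoint [Fintype A] (M : MonitoringStructure K A Q X S Y)
    (p : stdSimplex ℝ A) (i : K) (q : Q) (s : S i) : ℝ :=
  ∑ a, p a * M.m a q * M.g i a s

theorem signalJoint_nonneg [Fintype A] (M : MonitoringStructure K A Q X S Y)
    (p : stdSimplex ℝ A) (i : K) (q : Q) (s : S i) : 0 ≤ M.signalJoint p i q s :=
  Finset.sum_nonneg fun _ _ => by simp [mul_nonneg]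

theorem sum_signalJoint [Fintype A] (M : MonitoringStructure K A Q X S Y)
    (p : stdSimplex ℝ A) (i : K) : ∑ q, ∑ s, M.signalJoint p i q s = 1 := by
  unfold signalJoint
  rw [Finset.sum_congr rfl fun q _ => Finset.sum_comm, Finset.sum_comm]
  simp [← Finset.mul_sum]

open Classical in
/-- The joint law of a function of the mediator's signal and of the signal of player `i`. -/
noncomputable def mappedJoint [Fintype A] (M : MonitoringStructure K A Q X S Y)
    (p : stdSimplex ℝ A) (i : K) {R : Type*} (h : Q → R) (r : R) (s : S i) : ℝ :=
  ∑ q, if h q = r then M.signalJoint p i q s else 0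

theorem mappedJoint_nonneg [Fintype A] (M : MonitoringStructure K A Q X S Y)
    (p : stdSimplex ℝ A) (i : K) {R : Type*} (h : Q → R) (r : R) (s : S i) :
    0 ≤ M.mappedJoint p i h r s :=
  Finset.sum_nonneg fun _ _ => by split_ifs <;> simp [signalJoint_nonneg]

theorem sum_mappedJoint_left [Fintype A] (M : MonitoringStructure K A Q X S Y)
    (p : stdSimplex ℝ A) (i : K) {R : Type*} [Fintype R] (h : Q → R) (s : S i) :
    ∑ r, M.mappedJoint p i h r s = ∑ q, M.signalJoint p i q s := by
  classical
  simp only [mappedJoint]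
  rw [Finset.sum_comm]
  simp

theorem sum_mappedJoint [Fintype A] (M : MonitoringStructure K A Q X S Y)
    (p : stdSimplex ℝ A) (i : K) {R : Type*} [Fintype R] (h : Q → R) :
    ∑ r, ∑ s, M.mappedJoint p i h r s = 1 := by
  rw [Finset.sum_comm]
  simp_rw [sum_mappedJoint_left]
  rw [Finset.sum_comm, sum_signalJoint]

theorem essentialJoint_eq_mappedJoint [Fintype A] (M : MonitoringStructure K A Q X S Y)
    (p : stdSimplex ℝ A) (i : K) {R : Type*} (h : Q → R) :
    M.essentialJoint p h i = M.mappedJoint p i h := by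
  ext r s
  simp only [essentialJoint, jointMonitoring, essentialLaw, mappedJoint, signalJoint,
    Finset.mul_sum]
  rw [Finset.sum_comm]
  refine Finset.sum_congr rfl fun q _ => ?_
  split_ifs
  · exact Finset.sum_congr rfl fun a _ => by ring
  · simp

/-- A constant letter has posterior probability `1`; hence uncoded stages contribute a trivial
factor to the block moment. -/
theorem sourceMoment_mappedJoint_const [Fintype A] (M : MonitoringStructure K A Q X S Y)
    (p : stdSimplex ℝ A) (i : K) {R : Type*} [Fintype R] (r₀ : R) (ρ : ℝ) :
    sourceMoment (M.mappedJoint p i fun _ => r₀) ρ = 1 := by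
  simp only [sourceMoment, sum_mappedJoint_left]
  rw [← M.sum_signalJoint p i, Finset.sum_comm]
  conv_rhs => rw [Finset.sum_comm]
  refine Finset.sum_congr rfl fun s _ => ?_
  rw [Finset.sum_eq_single r₀]
  · simp only [mappedJoint, if_true]
    rcases eq_or_ne (∑ q, M.signalJoint p i q s) 0 with h | h
    · simp [h]
    · simp [div_self h]
  · intro r _ hr
    simp [mappedJoint, hr.symm]
  · simp

section BlockProb

variable [Fintype A] [∀ i, Fintype (Y i)]

theorem sum_block_weights (M : MonitoringStructure K A Q X S Y) (p : stdSimplex ℝ A) {n : ℕ}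
    (i : K) (c : (Fin n → Q) → Fin n → X) :
    ∑ a : Fin n → A, ∑ q : Fin n → Q, ∑ s : Fin n → S i, ∑ y : Fin n → Y i,
      ∏ t, p (a t) * M.m (a t) (q t) * M.g i (a t) (s t) *
        M.marginalChannel i (c q t) (y t) = 1 := by
  -- The input at each stage depends on the whole word `q`, so the outputs are summed out before the
  -- remaining weights factor over stages.
  have hy : ∀ (a : Fin n → A) (q : Fin n → Q) (s : Fin n → S i), ∑ y : Fin n → Y i,
      ∏ t, p (a t) * M.m (a t) (q t) * M.g i (a t) (s t) * M.marginalChannel i (c q t) (y t) =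
      ∏ t, p (a t) * M.m (a t) (q t) * M.g i (a t) (s t) := fun a q s => by
    rw [← Fintype.prod_sum fun t y => p (a t) * M.m (a t) (q t) * M.g i (a t) (s t) *
      M.marginalChannel i (c q t) y]
    simp [← Finset.mul_sum, sum_marginalChannel]
  simp_rw [hy]
  have hs : ∀ (a : Fin n → A) (q : Fin n → Q), ∑ s : Fin n → S i,
      ∏ t, p (a t) * M.m (a t) (q t) * M.g i (a t) (s t) =
      ∏ t, p (a t) * M.m (a t) (q t) := fun a q => by
    rw [← Fintype.prod_sum fun t s => p (a t) * M.m (a t) (q t) * M.g i (a t) s]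
    simp [← Finset.mul_sum]
  simp_rw [hs]
  rw [sum_sum_prod fun _ a q => p a * M.m a q]
  simp [← Finset.mul_sum]

open Classical in
/-- The union bound: an event that contains the complement of `B`. -/
theorem one_sub_le_blockProb (M : MonitoringStructure K A Q X S Y) (p : stdSimplex ℝ A)
    {R : Type*} {n : ℕ} (C : BlockCode A Q X S Y R n) (i : K)
    {E B : (Fin n → A) → (Fin n → Q) → (Fin n → S i) → (Fin n → Y i) → Prop}
    (hEB : ∀ a q s y, ¬ B a q s y → E a q s y) :
    1 - M.blockProb p C i B ≤ M.blockProb p C i E := by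
  rw [← M.sum_block_weights p i fun q => C.φ fun u => C.h (q u), sub_le_iff_le_add]
  simp only [blockProb, ← Finset.sum_add_distrib]
  refine Finset.sum_le_sum fun a _ => Finset.sum_le_sum fun q _ => Finset.sum_le_sum fun s _ =>
    Finset.sum_le_sum fun y _ => ?_
  have h0 : 0 ≤ ∏ t, p (a t) * M.m (a t) (q t) * M.g i (a t) (s t) *
      M.marginalChannel i (C.φ (fun u => C.h (q u)) t) (y t) :=
    Finset.prod_nonneg fun t _ => by
      have := M.marginalChannel_nonneg i (C.φ (fun u => C.h (q u)) t) (y t)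
      have h1 : 0 ≤ p (a t) * M.m (a t) (q t) * M.g i (a t) (s t) := by simp [mul_nonneg]
      exact mul_nonneg h1 this
  by_cases hB : B a q s y
  · rw [if_pos hB]
    split_ifs <;> linarith
  · rw [if_neg hB, if_pos (hEB a q s y hB)]
    linarith

open Classical in
/-- The law of a block in which only the letters `H t (q t)` are encoded. -/
theorem blockProb_eq_sum (M : MonitoringStructure K A Q X S Y) (p : stdSimplex ℝ A)
    {R R' : Type*} [Fintype R'] {n : ℕ} (C : BlockCode A Q X S Y R n) (i : K)
    (H : Fin n → Q → R') (c : (Fin n → R') → Fin n → X)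
    (hc : ∀ q : Fin n → Q, C.φ (fun u => C.h (q u)) = c fun t => H t (q t))
    (B : (Fin n → R') → (Fin n → S i) → (Fin n → Y i) → Prop) :
    M.blockProb p C i (fun _ q s y => B (fun t => H t (q t)) s y) =
      ∑ w : Fin n → R', ∑ s : Fin n → S i, ∑ y : Fin n → Y i, if B w s y then
        (∏ t, M.mappedJoint p i (H t) (w t) (s t)) * ∏ t, M.marginalChannel i (c w t) (y t)
      else 0 := by
  simp only [blockProb, hc]
  rw [Finset.sum_comm]
  calc _ = ∑ q : Fin n → Q, ∑ s : Fin n → S i, ∑ y : Fin n → Y i,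
        (∏ t, M.signalJoint p i (q t) (s t)) * if B (fun t => H t (q t)) s y then
          ∏ t, M.marginalChannel i (c (fun t => H t (q t)) t) (y t) else 0 := by
        refine Finset.sum_congr rfl fun q _ => ?_
        rw [Finset.sum_comm]
        refine Finset.sum_congr rfl fun s _ => ?_
        rw [Finset.sum_comm]
        refine Finset.sum_congr rfl fun y _ => ?_
        split_ifs
        · simp only [signalJoint]
          rw [Fintype.prod_sum, Finset.sum_mul]
          exact Finset.sum_congr rfl fun a _ => Finset.prod_mul_distrib
        · simp
    _ = _ := by
        rw [Finset.sum_comm]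
        conv_rhs => rw [Finset.sum_comm]
        refine Finset.sum_congr rfl fun s _ => ?_
        rw [Finset.sum_comm]
        conv_rhs => rw [Finset.sum_comm]
        refine Finset.sum_congr rfl fun y _ => ?_
        rw [sum_prod_mul_comp (fun t q => M.signalJoint p i q (s t)) H fun w =>
          if B w s y then ∏ t, M.marginalChannel i (c w t) (y t) else 0]
        simp only [mappedJoint, mul_ite, mul_zero]

end BlockProb

end MonitoringStructure

/-- A source of zero conditional entropy is determined by the side information. -/
theorem eq_of_condEntropyOf_nonpos {W S : Type*} [Fintype W] [Fintype S] {P : W → S → ℝ}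
    (hP : ∀ w s, 0 ≤ P w s) (h : condEntropyOf P ≤ 0) {w w' : W} {s : S} (hw : P w s ≠ 0)
    (hw' : P w' s ≠ 0) : w' = w := by
  by_contra hne
  have hpos : ∀ {w}, P w s ≠ 0 → 0 < P w s := fun hw => lt_of_le_of_ne (hP _ s) (Ne.symm hw)
  have hterm : ∀ w s, 0 ≤ P w s * Real.log (∑ w', P w' s) - P w s * Real.log (P w s) := by
    intro w s
    rcases (hP w s).eq_or_lt with h0 | h0
    · simp [← h0]
    rw [← mul_sub]
    exact mul_nonneg h0.le (sub_nonneg.2 (Real.log_le_log h0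
      (Finset.single_le_sum (fun w' _ => hP w' s) (Finset.mem_univ w))))
  -- Two words compatible with `s` make one of the nonnegative terms of the conditional entropy
  -- strictly positive.
  have hlt : P w s < ∑ w', P w' s := by
    classical
    have := Finset.sum_le_sum_of_subset_of_nonneg (Finset.subset_univ {w, w'})
      fun v _ _ => hP v s
    rw [Finset.sum_pair (Ne.symm hne)] at this
    linarith [hpos hw']
  have h1 : 0 < P w s * Real.log (∑ w', P w' s) - P w s * Real.log (P w s) := by
    rw [← mul_sub]
    exact mul_pos (hpos hw) (sub_pos.2 (Real.log_lt_log (hpos hw) hlt))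
  rw [condEntropyOf_eq_sum] at h
  have h2 := Finset.single_le_sum (fun s _ => hterm w s) (Finset.mem_univ s)
  have h3 := Finset.single_le_sum (f := fun w => ∑ s,
      (P w s * Real.log (∑ w', P w' s) - P w s * Real.log (P w s)))
    (fun w _ => Finset.sum_nonneg fun s _ => hterm w s) (Finset.mem_univ w)
  linarith

/-! ### Identification of profiles and block codes -/

namespace MonitoringStructure

variable {K A Q X : Type*} {S Y : K → Type*} [Fintype K] [Fintype Q]
  [∀ i, Fintype (S i)] [Fintype (∀ i, Y i)]

/-- The private signal and the color of the mediator's signal identify the action profile. -/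
theorem exists_preciseVia [Nonempty A] (M : MonitoringStructure K A Q X S Y) {ε x y : ℝ}
    (hx : x ≤ 1) (hy : y ≤ 1) (hxy : x + y - x * y ≤ ε) {κ : Q → ActionClass M.m} {i : K}
    (hc : ColoringCondition (M.g i) M.m κ x y) {R : Type*} (h : (M.biAuxiliaryGraph κ).Coloring R)
    [Fintype R] :
    ∃ T : S i × R → A, PreciseVia (M.jointMonitoring h i) id T ε := by
  classical
  obtain ⟨⟨U, hU⟩, hκ, hcol⟩ := hc
  let good : S i × R → A → Prop := fun σ a =>
    U σ.1 = actionClass (M.g i) a ∧ ∃ q, h q = σ.2 ∧ κ q = actionClass M.m a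
  have huniq : ∀ σ a b, good σ a → good σ b → a = b := by
    rintro σ a b ⟨ha, q, hq, hqa⟩ ⟨hb, q', hq', hqb⟩
    by_contra hab
    have hadj : (auxiliaryGraph (M.g i)).Adj a b := ⟨hab, Quotient.exact (ha.symm.trans hb)⟩
    -- The coloring condition excludes `q = q'`, which adjacency in the bi-auxiliary graph does not
    -- cover.
    have hne : q ≠ q' := fun e => hcol a b hadj (by rw [← hqa, ← hqb, e])
    exact h.valid (show (M.biAuxiliaryGraph κ).Adj q q' from
      ⟨hne, i, a, b, hadj, hqa, hqb⟩) (hq.trans hq'.symm)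
  refine ⟨fun σ => if e : ∃ a, good σ a then e.choose else Classical.arbitrary A, fun a => ?_⟩
  set T : S i × R → A := fun σ => if e : ∃ a, good σ a then e.choose else Classical.arbitrary A
  have hT : ∀ σ, good σ a → T σ = a := fun σ hσ => by
    have e : ∃ a, good σ a := ⟨a, hσ⟩
    simp only [T, dif_pos e]
    exact huniq σ _ _ e.choose_spec hσ
  have hprod : (∑ s, if U s = actionClass (M.g i) a then M.g i a s else 0) *
      (∑ q, if κ q = actionClass M.m a then M.m a q else 0) ≤
      ∑ σ : S i × R, if T σ = a then M.jointMonitoring h i a σ else 0 := by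
    rw [Fintype.sum_prod_type, Finset.sum_mul]
    refine Finset.sum_le_sum fun s _ => ?_
    have hL : ∀ r, (if T (s, r) = a then M.jointMonitoring h i a (s, r) else 0) =
        ∑ q, if h q = r then (if T (s, r) = a then M.g i a s * M.m a q else 0) else 0 := by
      intro r
      simp only [jointMonitoring, essentialLaw, Finset.mul_sum]
      split_ifs
      · exact Finset.sum_congr rfl fun q _ => by split_ifs <;> simp
      · simp
    simp_rw [hL]
    rw [Finset.sum_comm, Finset.mul_sum]
    refine Finset.sum_le_sum fun q _ => ?_
    rw [Finset.sum_ite_eq, if_pos (Finset.mem_univ _)]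
    by_cases h1 : U s = actionClass (M.g i) a ∧ κ q = actionClass M.m a
    · rw [if_pos (hT (s, h q) ⟨h1.1, q, rfl, h1.2⟩), if_pos h1.1, if_pos h1.2]
    · have hz : (if U s = actionClass (M.g i) a then M.g i a s else 0) *
          (if κ q = actionClass M.m a then M.m a q else 0) = 0 := by
        by_cases h2 : U s = actionClass (M.g i) a
        · rw [if_neg fun h3 => h1 ⟨h2, h3⟩, mul_zero]
        · rw [if_neg h2, zero_mul]
      rw [hz]
      split_ifs
      · exact mul_nonneg (by simp) (by simp)
      · exact le_rfl
  have hg : 1 - x ≤ ∑ s, if U s = actionClass (M.g i) a then M.g i a s else 0 := by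
    convert! hU a
  have hm : 1 - y ≤ ∑ q, if κ q = actionClass M.m a then M.m a q else 0 := by
    convert! hκ a
  calc 1 - ε ≤ (1 - x) * (1 - y) := by linarith
    _ ≤ _ := mul_le_mul hg hm (by linarith) (by linarith)
    _ ≤ _ := hprod
    _ = _ := Finset.sum_congr rfl fun σ _ => by simp only [id]

section Codes

variable [Fintype A] [∀ i, Fintype (Y i)]

open Classical in
/-- Block codes at positive slack: `k` out of `n` letters are encoded over `n` channel uses. -/
theorem exists_blockCode [Fintype X] (M : MonitoringStructure K A Q X S Y) (p : stdSimplex ℝ A)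
    {N : ℕ} (h : Q → Fin N) (r₀ : Fin N) {k n : ℕ} (hk : k ≤ n) (hn : 1 ≤ n) {η : ℝ}
    (hη : (n : ℝ) - k ≤ η * n) (μ : stdSimplex ℝ X)
    (hrate : ∀ i, k * condEntropyOf (M.essentialJoint p h i) <
      n * mutualInfoOf fun x (y : Y i) => μ x * M.marginalChannel i x y)
    (T : ∀ i, S i × Fin N → A) {δ : ℝ} (hδ : 0 < δ) :
    ∃ (l : ℕ) (C : BlockCode A Q X S Y (Fin N) l), 1 ≤ l ∧ C.h = h ∧ ∀ i,
      1 - δ ≤ M.blockProb p C i (fun _ q s y =>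
        ((Finset.univ.filter fun t => C.ψ i y s t ≠ T i (s t, C.h (q t))).card : ℝ) ≤ η * l) := by
  have hexp := fun i => exists_exponent (M.mappedJoint_nonneg p i h) (M.sum_mappedJoint p i h)
    (fun x => stdSimplex.zero_le μ x) (stdSimplex.sum_eq_one μ) (M.marginalChannel_nonneg i)
    (M.sum_marginalChannel i) (M.essentialJoint_eq_mappedJoint p i h ▸ hrate i)
  choose γ hγ ρ hρ hlt using hexp
  set A' : K → ℝ := fun i => sourceMoment (M.mappedJoint p i h) (ρ i)
  set B' : K → ℝ := fun i => channelMoment μ (M.marginalChannel i) (ρ i)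
  -- The one-shot error bound for `j` repetitions of the `(k, n)` scheme, with threshold `exp (γ i *
  -- j)`.
  have hlim : Filter.Tendsto (fun j : ℕ => ∑ i, ((Real.exp (γ i * ρ i) *
      (A' i ^ k * B' i ^ n)) ^ j + Real.exp (-γ i) ^ j)) Filter.atTop (nhds 0) := by
    rw [show (0 : ℝ) = ∑ i : K, (0 + 0) by simp]
    refine tendsto_finsetSum _ fun i _ => Filter.Tendsto.add
      (tendsto_pow_atTop_nhds_zero_of_lt_one ?_ (hlt i))
      (tendsto_pow_atTop_nhds_zero_of_lt_one (Real.exp_pos _).le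
        (Real.exp_lt_one_iff.2 (neg_neg_of_pos (hγ i))))
    exact mul_nonneg (Real.exp_pos _).le (mul_nonneg
      (pow_nonneg (sourceMoment_nonneg (M.mappedJoint_nonneg p i h) _) _)
      (pow_nonneg (channelMoment_nonneg (fun x => stdSimplex.zero_le μ x)
        (M.marginalChannel_nonneg i) _) _))
  obtain ⟨j, hj, hj1⟩ := ((hlim.eventually_lt_const hδ).and (Filter.eventually_ge_atTop 1)).exists
  have hkn : k * j ≤ n * j := Nat.mul_le_mul_right _ hk
  -- The last `(n - k) * j` letters are replaced by the dummy `r₀`: they cost no rate and account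
  -- for all stages allowed to fail.
  let H : Fin (n * j) → Q → Fin N := fun t => if (t : ℕ) < k * j then h else fun _ => r₀
  have : Nonempty (Fin (n * j) → Fin N) := ⟨fun _ => r₀⟩
  obtain ⟨c, d, hcd⟩ := exists_codebook (W := Fin (n * j) → Fin N) (X := Fin (n * j) → X)
    (S := fun i => Fin (n * j) → S i) (Y := fun i => Fin (n * j) → Y i)
    (P := fun i w s => ∏ t, M.mappedJoint p i (H t) (w t) (s t))
    (μ := fun x => ∏ t, μ (x t)) (V := fun i x y => ∏ t, M.marginalChannel i (x t) (y t))
    (τ := fun i => Real.exp (γ i * j)) (ρ := ρ)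
    (fun i w s => Finset.prod_nonneg fun t _ => M.mappedJoint_nonneg p i _ _ _)
    (fun i => by
      rw [sum_sum_prod fun t r s => M.mappedJoint p i (H t) r s]
      simp [sum_mappedJoint])
    (fun x => Finset.prod_nonneg fun t _ => stdSimplex.zero_le μ _)
    (sum_codebook _ (stdSimplex.sum_eq_one μ))
    (fun i x y => Finset.prod_nonneg fun t _ => M.marginalChannel_nonneg i _ _)
    (fun i x => by
      rw [← Fintype.prod_sum fun t y => M.marginalChannel i (x t) y]
      simp [sum_marginalChannel])
    (fun i => Real.exp_pos _) hρ
  refine ⟨n * j, ⟨h, fun r => c fun t => if (t : ℕ) < k * j then r t else r₀,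
    fun i y s t => T i (s t, d i y s t)⟩, Nat.mul_pos hn hj1, rfl, fun i => ?_⟩
  refine le_trans ?_ (M.one_sub_le_blockProb p _ i
    (B := fun _ q s y => d i y s ≠ fun t => H t (q t)) ?_)
  · rw [M.blockProb_eq_sum p _ i H c (fun q => by
      simp only [H]
      congr 1
      ext t
      split_ifs <;> rfl) fun w s y => d i y s ≠ w]
    refine sub_le_sub_left (le_trans (le_of_eq ?_) ((hcd i).trans (le_trans (le_of_eq ?_) hj.le))) 1
    · congr!
    refine Finset.sum_congr rfl fun i _ => ?_
    congr 1
    · rw [sourceMoment_prod (fun t => M.mappedJoint p i (H t))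
          (fun t => M.mappedJoint_nonneg p i (H t)),
        channelMoment_prod _ _ (fun x => stdSimplex.zero_le μ x) (M.marginalChannel_nonneg i),
        Fintype.card_fin]
      have hS : ∏ t, sourceMoment (M.mappedJoint p i (H t)) (ρ i) = A' i ^ (k * j) := by
        have : ∀ t : Fin (n * j), sourceMoment (M.mappedJoint p i (H t)) (ρ i) =
            if (t : ℕ) < k * j then A' i else 1 := fun t => by
          simp only [H]
          split_ifs
          · rfl
          · exact M.sourceMoment_mappedJoint_const p i r₀ _
        simp_rw [this]
        rw [Finset.prod_ite, Finset.prod_const, Finset.prod_const_one, mul_one,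
          Fin.card_filter_val_lt, min_eq_right hkn]
      rw [hS, mul_pow, mul_pow, ← pow_mul, ← pow_mul, ← Real.exp_mul, ← Real.exp_nat_mul]
      congr 2
      ring
    · rw [one_div, ← Real.exp_neg, ← Real.exp_nat_mul]
      congr 1
      ring
  · intro a q s y hd
    rw [not_not] at hd
    have hsub : (Finset.univ.filter fun t : Fin (n * j) =>
        T i (s t, d i y s t) ≠ T i (s t, h (q t))) ⊆
        (Finset.univ.filter fun t : Fin (n * j) => (t : ℕ) < k * j)ᶜ := by
      intro t ht
      simp only [Finset.mem_filter, Finset.mem_univ, true_and, Finset.mem_compl] at ht ⊢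
      intro hlt
      refine ht ?_
      rw [hd]
      simp [H, hlt]
    have hcard := Finset.card_le_card hsub
    rw [Finset.card_compl, Fintype.card_fin, Fin.card_filter_val_lt, min_eq_right hkn] at hcard
    have hcast : ((Finset.univ.filter fun t : Fin (n * j) =>
        T i (s t, d i y s t) ≠ T i (s t, h (q t))).card : ℝ) ≤ n * j - k * j := by
      have := Nat.cast_le (α := ℝ).2 hcard
      rwa [Nat.cast_sub hkn, Nat.cast_mul, Nat.cast_mul] at this
    refine hcast.trans ?_
    push_cast
    nlinarith [mul_le_mul_of_nonneg_right hη (Nat.cast_nonneg (α := ℝ) j)]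

open Classical in
/-- If the side information determines the essential information, nothing has to be sent. -/
theorem exists_blockCode_of_condEntropyOf_nonpos [Nonempty X] (M : MonitoringStructure K A Q X S Y)
    (p : stdSimplex ℝ A) {N : ℕ} (h : Q → Fin N) (r₀ : Fin N)
    (hrate : ∀ i, condEntropyOf (M.essentialJoint p h i) ≤ 0) {η : ℝ} (hη : 0 ≤ η)
    (T : ∀ i, S i × Fin N → A) {δ : ℝ} (hδ : 0 < δ) :
    ∃ (l : ℕ) (C : BlockCode A Q X S Y (Fin N) l), 1 ≤ l ∧ C.h = h ∧ ∀ i,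
      1 - δ ≤ M.blockProb p C i (fun _ q s y =>
        ((Finset.univ.filter fun t => C.ψ i y s t ≠ T i (s t, C.h (q t))).card : ℝ) ≤ η * l) := by
  -- Any color compatible with `s` will do: zero conditional entropy leaves at most one.
  let D : ∀ i, S i → Fin N := fun i s =>
    if e : ∃ r, M.mappedJoint p i h r s ≠ 0 then e.choose else r₀
  refine ⟨1, ⟨h, fun _ _ => Classical.arbitrary X, fun i _ s t => T i (s t, D i (s t))⟩, le_rfl,
    rfl, fun i => ?_⟩
  refine le_trans ?_ (M.one_sub_le_blockProb p _ i
    (B := fun _ q s _ => (fun t => D i (s t)) ≠ fun t => h (q t)) ?_)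
  · rw [M.blockProb_eq_sum p _ i (fun _ => h) (fun _ _ => Classical.arbitrary X) (fun q => rfl)
      fun w s _ => (fun t => D i (s t)) ≠ w]
    rw [Finset.sum_eq_zero]
    · linarith
    intro w _
    refine Finset.sum_eq_zero fun s _ => Finset.sum_eq_zero fun y _ => ?_
    split_ifs with hne
    · obtain ⟨t, ht⟩ := Function.ne_iff.1 hne
      have h0 : M.mappedJoint p i h (w t) (s t) = 0 := by
        by_contra hw
        have e : ∃ r, M.mappedJoint p i h r (s t) ≠ 0 := ⟨_, hw⟩
        refine ht ?_
        simp only [D, dif_pos e]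
        exact eq_of_condEntropyOf_nonpos (M.mappedJoint_nonneg p i h)
          (M.essentialJoint_eq_mappedJoint p i h ▸ hrate i) hw e.choose_spec
      rw [Finset.prod_eq_zero (Finset.mem_univ t) h0, zero_mul]
    · rfl
  · intro a q s y hd
    rw [not_not] at hd
    have : ∀ t, D i (s t) = h (q t) := fun t => congrFun hd t
    simpa [this] using hη

end Codes

end MonitoringStructure

/-! ### Rate at most capacity, and rate below capacity -/

theorem theorem2 {K A Q X : Type*} {S Y : K → Type*} [Fintype K] [DecidableEq K] [Nonempty K]
    [Fintype A] [Fintype Q] [Fintype X] [Nonempty X] [∀ i, Fintype (S i)] [∀ i, Fintype (Y i)]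
    (p : stdSimplex ℝ A) (M : MonitoringStructure K A Q X S Y) (ε : ℝ) (hε : 0 < ε)
    (κ : Q → ActionClass M.m)
    (hcond1 : ∃ x ∈ Set.Icc (0 : ℝ) 1, ∃ y ∈ Set.Icc (0 : ℝ) 1, x + y - x * y ≤ ε ∧
      ∀ i, ColoringCondition (M.g i) M.m κ x y)
    (N : ℕ) (h : (M.biAuxiliaryGraph κ).Coloring (Fin N))
    (hmin : (M.biAuxiliaryGraph κ).chromaticNumber = N)
    (hcond2 : M.essentialRate p h ≤ M.commonCapacity) :
    (∀ η : ℝ, 0 < η → M.ReconstructsUpTo p ε η) ∧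
    (M.essentialRate p h < M.commonCapacity → M.Reconstructs p ε) := by
  obtain ⟨x, hx, y, hy, hxy, hc⟩ := hcond1
  obtain ⟨a₀, -⟩ : ∃ a, p a ≠ 0 := by
    by_contra! hp
    simpa [hp] using stdSimplex.sum_eq_one p
  obtain ⟨q₀, -⟩ : ∃ q, M.m a₀ q ≠ 0 := by
    by_contra! hp
    simpa [hp] using stdSimplex.sum_eq_one (M.m a₀)
  have : Nonempty A := ⟨a₀⟩
  have : Nonempty (stdSimplex ℝ X) := by
    classical exact ⟨⟨_, single_mem_stdSimplex ℝ (Classical.arbitrary X)⟩⟩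
  choose T hT using fun i => M.exists_preciseVia hx.2 hy.2 hxy (hc i) h
  have hrate : ∀ i, condEntropyOf (M.essentialJoint p h i) ≤ M.essentialRate p h := fun i =>
    le_ciSup (f := fun i => condEntropyOf (M.essentialJoint p h i)) (Set.finite_range _).bddAbove i
  have hcap : ∀ b, b < M.commonCapacity → ∃ μ : stdSimplex ℝ X, ∀ i,
      b < mutualInfoOf fun x (y : Y i) => μ x * M.marginalChannel i x y := fun b hb => by
    obtain ⟨μ, hμ⟩ := exists_lt_of_lt_ciSup hb
    exact ⟨μ, fun i => hμ.trans_le (ciInf_le (Set.finite_range _).bddBelow i)⟩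
  refine ⟨fun η hη δ hδ => ?_, fun hlt δ hδ => ?_⟩
  · rcases le_or_gt M.commonCapacity 0 with h0 | h0
    · obtain ⟨l, C, hl, hC, hP⟩ := M.exists_blockCode_of_condEntropyOf_nonpos p h (h q₀)
        (fun i => (hrate i).trans (hcond2.trans h0)) hη.le T hδ
      exact ⟨l, N, C, hl, fun i => ⟨T i, hC ▸ hT i, hP i⟩⟩
    -- Dropping one letter in `n > 1 / η` stays within the fraction `η`.
    · obtain ⟨n, hn⟩ := exists_nat_gt (1 / η)
      have hn0 : (0 : ℝ) < n := (one_div_pos.2 hη).trans hn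
      have hn1 : 1 ≤ n := Nat.cast_pos.1 hn0
      have hηn : 1 ≤ η * n := by
        rw [div_lt_iff₀ hη] at hn
        linarith
      have hcast : ((n - 1 : ℕ) : ℝ) = n - 1 := by push_cast [hn1]; ring
      -- Since the capacity is positive, this target lies strictly below it, and then `n * I > (n -
      -- 1) * C₀ ≥ (n - 1) * H` for every player.
      obtain ⟨μ, hμ⟩ := hcap ((n - 1) / n * M.commonCapacity) (by
        rw [div_mul_eq_mul_div, div_lt_iff₀ hn0]
        nlinarith)
      obtain ⟨l, C, hl, hC, hP⟩ := M.exists_blockCode p h (h q₀) (k := n - 1) (n := n)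
        (Nat.sub_le _ _) hn1 (η := η) (by rw [hcast]; linarith) μ (fun i => by
          have h1 := hμ i
          rw [div_mul_eq_mul_div, div_lt_iff₀ hn0] at h1
          have h2 := mul_le_mul_of_nonneg_left ((hrate i).trans hcond2)
            (Nat.cast_nonneg (α := ℝ) (n - 1))
          rw [hcast] at h2 ⊢
          linarith) T hδ
      exact ⟨l, N, C, hl, fun i => ⟨T i, hC ▸ hT i, hP i⟩⟩
  · obtain ⟨μ, hμ⟩ := hcap _ hlt
    -- With strict slack every letter is encoded, which permits `η = 0`.
    obtain ⟨l, C, hl, hC, hP⟩ := M.exists_blockCode p h (h q₀) (k := 1) (n := 1) le_rfl le_rfl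
      (η := 0) (by simp) μ (fun i => by simpa using (hrate i).trans_lt (hμ i)) T hδ
    exact ⟨l, N, C, hl, fun i => ⟨T i, hC ▸ hT i, hP i⟩⟩
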